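/- **Setting.** Consider a $K$-armed bandit. Arm $i\in[K]$ has reward distribution function $F_i$ with finite mean $\mu_i$; the arm $i^*$ of maximal mean $\mu^*=\mu_{i^*}$ is unique, and $\Delta_j=\mu^*-\mu_j$. In round $t=1,2,\dots$ the player pulls an arm $I_t$, chosen on the basis of the past. The clean reward $\tilde X_{i,t}\sim F_i$ is independent of the past. An adversary attacks in round $t$ with probability $\rho$, independently of the past. The player observes $X_t=\tilde X_{I_t,t}+\eta_t$ if there is an attack and $X_t=\tilde X_{I_t,t}$ otherwise. The attack value $\eta_t\in\mathbb R$ is arbitrary and unbounded and may depend on everything that has happened up to and including round $t$ (the past, $I_t$, and the rewards and attack occurrence of round $t$). The regret is $R_T=\mu^*T-\sum_{t=1}^T\mu_{I_t}$. For $0<p<1$ put $\theta_p(F)=\inf\{x: F(x)\ge p\}$; the median of a finite sample is $\theta_{1/2}$ of its empirical distribution function. **Algorithm med-E-UCB** with group size $G\ge 2$ and exploration parameters $b>0$, $\omega$, where $G\ge Kb\log G$. In the first $K\lceil b\log G\rceil$ rounds each arm is pulled $\lceil b\log G\rceil$ times. In every later round $t$ let $k=\lfloor t/G\rfloor$. If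 $k\ge1$ and $kG+1\le t\le kG+Kd_k$ with $d_k=\lceil b\log((k+1)G)\rceil-\lceil b\log(kG)\rceil$, then $I_t=\lceil (t-kG)/d_k\rceil$. Otherwise $I_t$ maximizes $\mathrm{med}_j(t-1)+\sqrt{\omega\log t/T_j(t-1)}$ over $j$ (ties broken arbitrarily), where $T_j(t-1)$ is the number of pulls of arm $j$ up to round $t-1$ and $\mathrm{med}_j(t-1)$ is the median of the rewards observed from them. **Assumption.** All $F_i$ are differentiable, and there are constants $0<s<\tfrac12$, $\xi>0$, $l>0$ such that for all $j\ne i^*$: $\theta_{1/2-s}(F_{i^*})>\theta_{1/2+s}(F_j)$ and $\inf\{F_j'(x):\theta_{1/2+s}(F_j)<x<\theta_{1/2+s}(F_j)+\xi\}\ge l$; moreover $\inf\{F_{i^*}'(x):\theta_{1/2-s}(F_{i^*})-\xi<x<\theta_{1/2-s}(F_{i^*})\}\ge l$. **Theorem.** Under this assumption let $\rho<s$, $T>G$, $b\ge\max\{\omega/\xi^2,\ 2/(s-\rho)^2\}$, $\omega\ge 3.5/l^2$ and $0<\delta<1$. Then, with probability at least $1-\delta$ over the rewards and the attack occurrences,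 the regret of med-E-UCB satisfies $$R_T\le\sum_{j\ne i^*}\Delta_j\left(b\log(2T)+\frac{4\omega\log T}{(\theta_{1/2-s}(F_{i^*})-\theta_{1/2+s}(F_j))^2}+e\Big(\frac{bK}{2\delta}\Big)^{1/4}+\frac{2K}{\delta}+3+\frac{\pi^2}{3}\right).$$ In particular there is a constant $C>0$, depending only on $K$, the reward distributions, $s$, $b$ and $\omega$, such that with probability at least $1-\delta$ one has $R_T\le C(\log T+1/\delta)$. -/

import Mathlib

open MeasureTheory ProbabilityTheory

noncomputable section

namespace MedEUCB

/-- The generalized `p`-quantile `inf {x : F x ≥ p}` of a distribution function `F`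
(meant for `0 < p < 1`). -/
def quantile (F : ℝ → ℝ) (p : ℝ) : ℝ :=
  sInf {x : ℝ | p ≤ F x}

/-- The empirical distribution function of the sample `(x τ)`, `τ ∈ S`. -/
def empiricalCDF (S : Finset ℕ) (x : ℕ → ℝ) (y : ℝ) : ℝ :=
  ((S.filter (fun τ => x τ ≤ y)).card : ℝ) / (S.card : ℝ)

/-- The sample median: the `1/2`-quantile of the empirical distribution. -/
def sampleMedian (S : Finset ℕ) (x : ℕ → ℝ) : ℝ :=
  quantile (empiricalCDF S x) (1 / 2)

/-- The mean of a reward distribution. -/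
def mean (ν : Measure ℝ) : ℝ := ∫ x, x ∂ν

/-! ### The algorithm. Rounds are numbered `1, 2, 3, …`, arms by `Fin K`. -/

/-- The rounds up to `t` in which arm `i` is pulled. -/
def pullRounds {K : ℕ} (I : ℕ → Fin K) (i : Fin K) (t : ℕ) : Finset ℕ :=
  (Finset.Icc 1 t).filter (fun τ => I τ = i)

/-- `T_i(t)`, the number of pulls of arm `i` up to round `t`. -/
def pulls {K : ℕ} (I : ℕ → Fin K) (i : Fin K) (t : ℕ) : ℕ :=
  (pullRounds I i t).card

/-- `med_i(t)`, the sample median of the rewards observed from arm `i` up to round `t`. -/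
def med {K : ℕ} (I : ℕ → Fin K) (X : ℕ → ℝ) (i : Fin K) (t : ℕ) : ℝ :=
  sampleMedian (pullRounds I i t) X

/-- The index `med_i(t-1) + √(w log t / T_i(t-1))` of arm `i` in round `t`. -/
def ucbIndex {K : ℕ} (w : ℝ) (I : ℕ → Fin K) (X : ℕ → ℝ) (i : Fin K) (t : ℕ) : ℝ :=
  med I X i (t - 1) + √(w * Real.log t / (pulls I i (t - 1) : ℝ))

/-- `⌈b log n⌉`. -/
def ceilLog (b : ℝ) (n : ℕ) : ℕ := ⌈b * Real.log n⌉₊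

/-- The number `⌈b log ((k+1)G)⌉ - ⌈b log (kG)⌉` of exploration pulls of each arm at the
beginning of block `k ≥ 1`. -/
def blockPulls (b : ℝ) (G k : ℕ) : ℕ := ceilLog b ((k + 1) * G) - ceilLog b (k * G)

/-- Round `t` (after the initialization) is a pure exploration round: with `k = ⌊t / G⌋`,
`k ≥ 1` and `kG + 1 ≤ t ≤ kG + K (⌈b log ((k+1)G)⌉ - ⌈b log (kG)⌉)`. -/
def IsExploration (K : ℕ) (b : ℝ) (G t : ℕ) : Prop :=
  1 ≤ t / G ∧ t / G * G + 1 ≤ t ∧ t ≤ t / G * G + K * blockPulls b G (t / G)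

/-- The sequence `I` of pulled arms and the sequence `X` of observed rewards form a run of
med-E-UCB with group size `G` and exploration parameters `b`, `w`. The order of the pulls in the
initialization and the choice among maximizers of the index are arbitrary. -/
structure IsRun (K G : ℕ) (b w : ℝ) (I : ℕ → Fin K) (X : ℕ → ℝ) : Prop where
  /-- Initialization: in the first `K ⌈b log G⌉` rounds each arm is pulled `⌈b log G⌉` times. -/
  init : ∀ i, pulls I i (K * ceilLog b G) = ceilLog b G
  /-- Pure exploration: `I_t = ⌈(t - kG) / (⌈b log ((k+1)G)⌉ - ⌈b log (kG)⌉)⌉`, arms being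
  numbered from `1` in this formula. -/
  explore : ∀ t, K * ceilLog b G < t → IsExploration K b G t →
    (I t : ℕ) + 1 = ⌈((t : ℝ) - ((t / G * G : ℕ) : ℝ)) / (blockPulls b G (t / G) : ℝ)⌉₊
  /-- UCB rounds: `I_t` maximizes the index. -/
  ucb : ∀ t, K * ceilLog b G < t → ¬ IsExploration K b G t →
    ∀ j, ucbIndex w I X j t ≤ ucbIndex w I X (I t) t

/-! ### The attacked bandit -/

/-- The `K`-armed bandit with reward distributions `ν i` under attack with probability `ρ`.
`clean i t` is the unattacked reward of arm `i` in round `t`, `attack t` the event that the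
adversary attacks in round `t`, `η t` the attack value and `arm t` the arm pulled. The σ-algebra
`ℱ t` is the information available after round `t`: the new rewards and the new attack event are
independent of `ℱ t`, the next arm is chosen from `ℱ t`, and the next attack value may depend in
an arbitrary way on `ℱ (t + 1)`, that is, on the whole past and on the current arm, rewards and
attack event. -/
structure IsAttackedBandit {Ω : Type*} [mΩ : MeasurableSpace Ω] (P : Measure Ω) {K : ℕ}
    (ν : Fin K → Measure ℝ) (ρ : ℝ) (ℱ : Filtration ℕ mΩ) (clean : Fin K → ℕ → Ω → ℝ)
    (attack : ℕ → Set Ω) (η : ℕ → Ω → ℝ) (arm : ℕ → Ω → Fin K) : Prop where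
  clean_adapted : ∀ i t, Measurable[ℱ (t + 1)] (clean i (t + 1))
  clean_law : ∀ i t, P.map (clean i (t + 1)) = ν i
  clean_indep : ∀ i t, Indep (MeasurableSpace.comap (clean i (t + 1)) inferInstance) (ℱ t) P
  attack_adapted : ∀ t, MeasurableSet[ℱ (t + 1)] (attack (t + 1))
  attack_prob : ∀ t, P.real (attack (t + 1)) = ρ
  attack_indep : ∀ t, Indep (MeasurableSpace.generateFrom {attack (t + 1)}) (ℱ t) P
  value_adapted : ∀ t, Measurable[ℱ (t + 1)] (η (t + 1))
  arm_predictable : ∀ t, Measurable[ℱ t] (arm (t + 1))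

open scoped Classical in
/-- The observed reward of round `t`: the clean reward of the pulled arm, plus the attack value
if the adversary attacks. -/
def observed {Ω : Type*} {K : ℕ} (clean : Fin K → ℕ → Ω → ℝ) (attack : ℕ → Set Ω)
    (η : ℕ → Ω → ℝ) (arm : ℕ → Ω → Fin K) (t : ℕ) (x : Ω) : ℝ :=
  if x ∈ attack t then clean (arm t x) t x + η t x else clean (arm t x) t x

/-- The regret `R_T = μ* T - ∑_{t=1}^T μ_{I_t}`, where `istar` is the optimal arm. -/
def regret {K : ℕ} (ν : Fin K → Measure ℝ) (istar : Fin K) (I : ℕ → Fin K) (T : ℕ) : ℝ :=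
  mean (ν istar) * T - ∑ t ∈ Finset.Icc 1 T, mean (ν (I t))

/-- The quantile gap `θ_{1/2-s}(F_{i*}) - θ_{1/2+s}(F_j)`. -/
def quantileGap {K : ℕ} (ν : Fin K → Measure ℝ) (istar : Fin K) (s : ℝ) (j : Fin K) : ℝ :=
  quantile (cdf (ν istar)) (1 / 2 - s) - quantile (cdf (ν j)) (1 / 2 + s)

/-- The assumption on the reward distributions, with constants `s`, `ξ`, `l`. -/
structure QuantileAssumption {K : ℕ} (ν : Fin K → Measure ℝ) (istar : Fin K) (s ξ l : ℝ) :
    Prop where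
  s_pos : 0 < s
  s_lt : s < 1 / 2
  ξ_pos : 0 < ξ
  l_pos : 0 < l
  gap : ∀ j, j ≠ istar →
    quantile (cdf (ν j)) (1 / 2 + s) < quantile (cdf (ν istar)) (1 / 2 - s)
  differentiable : ∀ i, Differentiable ℝ (cdf (ν i))
  density_star : l ≤ sInf (deriv (cdf (ν istar)) ''
    Set.Ioo (quantile (cdf (ν istar)) (1 / 2 - s) - ξ) (quantile (cdf (ν istar)) (1 / 2 - s)))
  density_other : ∀ j, j ≠ istar → l ≤ sInf (deriv (cdf (ν j)) ''
    Set.Ioo (quantile (cdf (ν j)) (1 / 2 + s)) (quantile (cdf (ν j)) (1 / 2 + s) + ξ))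

end MedEUCB

end

open MedEUCB

open MedEUCB
open scoped ENNReal

/-! A sample median can lie on the wrong side of a level only if at least half of the sample does.
An observed reward does so only if its clean reward does or its round is attacked, so the size of
the attack values is irrelevant. By the quantile and density assumption a clean reward is beyond its
quantile by `ε ≤ ξ` with probability at most `1/2 - s - l ε`. A pull is therefore bad with
conditional probability at most `1/2 - g`, where `g = s - ρ + l ε`.

An exponential supermartingale (`measureReal_card_le_two_mul_card_le`) shows that `n` adaptively
chosen pulls are at least half bad with probability at most `exp (-n g²)`. For `ε = min √(w log t /
n) ξ` and `n ≥ (b log t) / 2` this is at most `t⁻³` (`three_mul_log_le`). A union over `n < t`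
bounds the failure probability of one confidence bound in round `t` by `t⁻²`. Forced exploration
supplies the required number of pulls in every index round (`IsRun.mul_log_le_two_mul_pulls`).

The expected number of failures is then at most `K`, and Markov's inequality bounds it by `2K/δ`
with probability at least `1 - δ`. The rest is the deterministic UCB argument
(`IsRun.pulls_le_of_confidence`): a pull of arm `j` is scheduled, or comes while `j` has few pulls,
or is charged to a failure. The fourth-root term, `π²/3` and one unit of the `3` are slack. -/

namespace MedEUCB

/-! ### Sample medians and counting -/

section Median

variable {S : Finset ℕ} {x : ℕ → ℝ} {y : ℝ}

lemma sampleMedian_set_bddBelow (S : Finset ℕ) (x : ℕ → ℝ) :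
    BddBelow {y : ℝ | 1 / 2 ≤ empiricalCDF S x y} := by
  obtain ⟨m, hm⟩ := (S.image x).bddBelow
  refine ⟨m, fun y hy => ?_⟩
  by_contra! hlt
  have : S.filter (fun τ => x τ ≤ y) = ∅ := by
    refine Finset.filter_eq_empty_iff.2 fun τ hτ hle => ?_
    have := hm (Finset.mem_coe.2 (Finset.mem_image_of_mem x hτ))
    linarith
  simp only [Set.mem_ofPred_eq, empiricalCDF, this] at hy
  norm_num at hy

lemma sampleMedian_set_nonempty (hS : S.Nonempty) :
    {y : ℝ | 1 / 2 ≤ empiricalCDF S x y}.Nonempty := by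
  obtain ⟨m, hm⟩ := (S.image x).bddAbove
  refine ⟨m, ?_⟩
  have : S.filter (fun τ => x τ ≤ m) = S :=
    Finset.filter_true_of_mem fun τ hτ =>
      hm (Finset.mem_coe.2 (Finset.mem_image_of_mem x hτ))
  have hc : (0 : ℝ) < S.card := by exact_mod_cast hS.card_pos
  simp only [Set.mem_ofPred_eq, empiricalCDF, this]
  rw [div_self hc.ne']; norm_num

/-- If the sample median exceeds `y`, at least half of the sample exceeds `y`. -/
lemma card_le_of_lt_sampleMedian (hS : S.Nonempty) (h : y < sampleMedian S x) :
    S.card ≤ 2 * (S.filter (fun τ => y < x τ)).card := by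
  have h1 : empiricalCDF S x y < 1 / 2 := by
    by_contra! hle
    exact absurd (csInf_le (sampleMedian_set_bddBelow S x) hle) (not_le.2 h)
  have hc : (0 : ℝ) < S.card := by exact_mod_cast hS.card_pos
  rw [empiricalCDF, div_lt_div_iff₀ hc two_pos] at h1
  have h2 := Finset.card_filter_add_card_filter_not (s := S) (fun τ => x τ ≤ y)
  simp only [not_le] at h2
  have h3 : (S.filter (fun τ => x τ ≤ y)).card * 2 < 1 * S.card := by exact_mod_cast h1
  omega

/-- If the sample median is below `y`, at least half of the sample is at most `y`. -/
lemma card_le_of_sampleMedian_lt (hS : S.Nonempty) (h : sampleMedian S x < y) :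
    S.card ≤ 2 * (S.filter (fun τ => x τ ≤ y)).card := by
  obtain ⟨z, hz, hzy⟩ := exists_lt_of_csInf_lt (sampleMedian_set_nonempty hS) h
  have hc : (0 : ℝ) < S.card := by exact_mod_cast hS.card_pos
  rw [Set.mem_ofPred_eq, empiricalCDF, div_le_div_iff₀ two_pos hc] at hz
  have h3 : 1 * S.card ≤ (S.filter (fun τ => x τ ≤ z)).card * 2 := by exact_mod_cast hz
  have h4 : (S.filter (fun τ => x τ ≤ z)).card ≤ (S.filter (fun τ => x τ ≤ y)).card :=
    Finset.card_le_card fun τ hτ => by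
      rw [Finset.mem_filter] at hτ ⊢
      exact ⟨hτ.1, hτ.2.trans hzy.le⟩
  omega

end Median

/-! ### Quantiles of a continuous distribution function -/

section Quantile

variable (ν : Measure ℝ) {p : ℝ}

lemma quantile_set_bddBelow (hp : 0 < p) : BddBelow {x : ℝ | p ≤ cdf ν x} := by
  obtain ⟨m, hm⟩ := ((tendsto_cdf_atBot ν).eventually (gt_mem_nhds hp)).exists
  refine ⟨m, fun y hy => ?_⟩
  by_contra! hlt
  exact absurd (hy.trans (monotone_cdf ν hlt.le)) (not_le.2 hm)

lemma le_cdf_quantile (hc : Continuous (cdf ν)) (h0 : 0 < p) (h1 : p < 1) :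
    p ≤ cdf ν (quantile (cdf ν) p) := by
  obtain ⟨m, hm⟩ := ((tendsto_cdf_atTop ν).eventually (lt_mem_nhds h1)).exists
  have hcl : IsClosed {x : ℝ | p ≤ cdf ν x} := isClosed_le continuous_const hc
  exact hcl.csInf_mem ⟨m, hm.le⟩ (quantile_set_bddBelow ν h0)

lemma cdf_quantile_le (hc : Continuous (cdf ν)) (h0 : 0 < p) :
    cdf ν (quantile (cdf ν) p) ≤ p := by
  have hcl : IsClosed {x : ℝ | cdf ν x ≤ p} := isClosed_le hc continuous_const
  have hsub : Set.Iio (quantile (cdf ν) p) ⊆ {x : ℝ | cdf ν x ≤ p} := fun x hx => by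
    by_contra! hlt
    simp only [Set.mem_ofPred_eq, not_le] at hlt
    exact absurd (csInf_le (quantile_set_bddBelow ν h0) hlt.le) (not_le.2 hx)
  have := hcl.closure_subset_iff.2 hsub
  rw [closure_Iio] at this
  exact this Set.self_mem_Iic

lemma mul_sub_le_cdf_sub {l a c : ℝ} (hd : Differentiable ℝ (cdf ν)) (hac : a ≤ c)
    {u v : ℝ} (hsub : Set.Ioo a c ⊆ Set.Ioo u v)
    (h : l ≤ sInf (deriv (cdf ν) '' Set.Ioo u v)) :
    l * (c - a) ≤ cdf ν c - cdf ν a := by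
  -- Monotonicity of the cdf makes the derivatives nonnegative, so `sInf` is a true lower bound and
  -- not a default value.
  have hb : BddBelow (deriv (cdf ν) '' Set.Ioo u v) := by
    refine ⟨0, ?_⟩
    rintro _ ⟨x, -, rfl⟩
    exact (monotone_cdf ν).deriv_nonneg
  refine (convex_Icc a c).mul_sub_le_image_sub_of_le_deriv hd.continuous.continuousOn
    hd.differentiableOn (fun x hx => ?_) a (Set.left_mem_Icc.2 hac) c (Set.right_mem_Icc.2 hac) hac
  rw [interior_Icc] at hx
  exact h.trans (csInf_le hb ⟨x, hsub hx, rfl⟩)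

end Quantile

/-! ### Tail bounds from the quantile assumption -/

section Assumption

variable {K : ℕ} {ν : Fin K → Measure ℝ} [∀ i, IsProbabilityMeasure (ν i)] {istar : Fin K}
  {s ξ l : ℝ}

/-- The cdf is at least `1/2 + s` at the quantile and grows with slope at least `l` over the next
`ξ`. The margin `s` is what absorbs the attacks; `l ε` is the statistical gain. -/
lemma QuantileAssumption.real_Ioi_le (h : QuantileAssumption ν istar s ξ l) {j : Fin K}
    (hj : j ≠ istar) {ε : ℝ} (h0 : 0 ≤ ε) (hε : ε ≤ ξ) :
    (ν j).real (Set.Ioi (quantile (cdf (ν j)) (1 / 2 + s) + ε)) ≤ 1 / 2 - s - l * ε := by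
  have hs := h.s_pos
  have hs' := h.s_lt
  have h1 := le_cdf_quantile (ν j) (h.differentiable j).continuous (p := 1 / 2 + s)
    (by linarith) (by linarith)
  have h2 := mul_sub_le_cdf_sub (ν j) (h.differentiable j)
    (a := quantile (cdf (ν j)) (1 / 2 + s)) (c := quantile (cdf (ν j)) (1 / 2 + s) + ε)
    (by linarith) (Set.Ioo_subset_Ioo le_rfl (by linarith)) (h.density_other j hj)
  rw [← Set.compl_Iic, probReal_compl_eq_one_sub measurableSet_Iic, ← cdf_eq_real]
  ring_nf at h1 h2 ⊢
  linarith

lemma QuantileAssumption.real_Iic_le (h : QuantileAssumption ν istar s ξ l)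
    {ε : ℝ} (h0 : 0 ≤ ε) (hε : ε ≤ ξ) :
    (ν istar).real (Set.Iic (quantile (cdf (ν istar)) (1 / 2 - s) - ε)) ≤ 1 / 2 - s - l * ε := by
  have hs := h.s_pos
  have hs' := h.s_lt
  have h1 := cdf_quantile_le (ν istar) (h.differentiable istar).continuous (p := 1 / 2 - s)
    (by linarith)
  have h2 := mul_sub_le_cdf_sub (ν istar) (h.differentiable istar)
    (a := quantile (cdf (ν istar)) (1 / 2 - s) - ε) (c := quantile (cdf (ν istar)) (1 / 2 - s))
    (by linarith) (Set.Ioo_subset_Ioo (by linarith) le_rfl) h.density_star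
  rw [← cdf_eq_real]
  ring_nf at h1 h2 ⊢
  linarith

end Assumption

/-! ### Counting pulls -/

section Pulls

variable {K : ℕ} (I : ℕ → Fin K) (i : Fin K)

lemma pulls_mono {m n : ℕ} (h : m ≤ n) : pulls I i m ≤ pulls I i n :=
  Finset.card_le_card (Finset.filter_subset_filter _ (Finset.Icc_subset_Icc le_rfl h))

lemma pulls_lt_of_eq {m t : ℕ} (hmt : m < t) (ht : I t = i) : pulls I i m < pulls I i t := by
  refine Finset.card_lt_card (Finset.ssubset_iff_subset_ne.2 ⟨Finset.filter_subset_filter _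
    (Finset.Icc_subset_Icc le_rfl hmt.le), fun h => ?_⟩)
  have : t ∈ pullRounds I i m := by
    refine h.symm ▸ Finset.mem_filter.2 ⟨Finset.mem_Icc.2 ⟨by omega, le_rfl⟩, ht⟩
  simp [pullRounds] at this
  omega

/-- On the rounds that pull `i`, the count before the round is strictly increasing, hence injective,
and here it takes values in `{0, …, u}`. -/
lemma card_filter_pulls_le (S : Finset ℕ) (u : ℕ) (hS : ∀ t ∈ S, 1 ≤ t) :
    (S.filter (fun t => I t = i ∧ pulls I i (t - 1) ≤ u)).card ≤ u + 1 := by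
  rw [← Finset.card_range (u + 1)]
  refine Finset.card_le_card_of_injOn (fun t => pulls I i (t - 1)) (fun t ht => ?_) ?_
  · have := (Finset.mem_filter.1 ht).2.2
    simp; omega
  · have key : ∀ a c, 1 ≤ a → I a = i → a < c → pulls I i (a - 1) ≠ pulls I i (c - 1) := by
      intro a c ha hI hac
      have h1 := pulls_lt_of_eq I i (m := a - 1) (by omega) hI
      have h2 := pulls_mono I i (m := a) (n := c - 1) (by omega)
      omega
    intro a ha c hc hac
    simp only [Finset.coe_filter, Set.mem_ofPred_eq] at ha hc
    rcases lt_trichotomy a c with h | h | h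
    · exact absurd hac (key a c (hS a ha.1) ha.2.1 h)
    · exact h
    · exact absurd hac.symm (key c a (hS c hc.1) hc.2.1 h)

end Pulls

/-! ### The exploration schedule -/

section Schedule

variable {K G : ℕ} {b w : ℝ} {I : ℕ → Fin K} {X : ℕ → ℝ}

lemma ceilLog_mono (hb : 0 ≤ b) {m n : ℕ} (h : m ≤ n) : ceilLog b m ≤ ceilLog b n := by
  refine Nat.ceil_mono (mul_le_mul_of_nonneg_left ?_ hb)
  rcases Nat.eq_zero_or_pos m with rfl | hm
  · simpa using Real.log_natCast_nonneg n
  · exact Real.log_le_log (by exact_mod_cast hm) (by exact_mod_cast h)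

lemma le_ceilLog (b : ℝ) (n : ℕ) : b * Real.log n ≤ ceilLog b n := Nat.le_ceil _

lemma ceilLog_lt (hb : 0 ≤ b) (n : ℕ) : (ceilLog b n : ℝ) < b * Real.log n + 1 :=
  Nat.ceil_lt_add_one (mul_nonneg hb (Real.log_natCast_nonneg n))

lemma ceilLog_add_blockPulls (hb : 0 ≤ b) (G k : ℕ) :
    ceilLog b (k * G) + blockPulls b G k = ceilLog b ((k + 1) * G) :=
  Nat.add_sub_of_le (ceilLog_mono hb (Nat.mul_le_mul_right G (Nat.le_succ k)))

lemma ceilLog_add_sum_blockPulls (hb : 0 ≤ b) (G m : ℕ) :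
    ceilLog b G + ∑ k ∈ Finset.Icc 1 m, blockPulls b G k = ceilLog b ((m + 1) * G) := by
  induction m with
  | zero => simp
  | succ m ih =>
    rw [Finset.sum_Icc_succ_top (by omega), ← add_assoc, ih, ceilLog_add_blockPulls hb]

/-- The arm pulled in a pure exploration round. -/
lemma IsRun.arm_eq_iff (h : IsRun K G b w I X) {t : ℕ} (h0 : K * ceilLog b G < t)
    (he : IsExploration K b G t) (i : Fin K) :
    I t = i ↔ t / G * G + i * blockPulls b G (t / G) < t ∧
      t ≤ t / G * G + (i + 1) * blockPulls b G (t / G) := by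
  have hex := h.explore t h0 he
  obtain ⟨-, h2, h3⟩ := he
  set d := blockPulls b G (t / G)
  set c := t / G * G
  have hd : 0 < d := by
    rcases Nat.eq_zero_or_pos d with hd | hd
    · rw [hd] at h3; omega
    · exact hd
  have hd' : (0 : ℝ) < d := by exact_mod_cast hd
  have : I t = i ↔ ⌈((t : ℝ) - (c : ℝ)) / (d : ℝ)⌉₊ = (i : ℕ) + 1 := by
    rw [← hex, Fin.ext_iff]; omega
  rw [this, Nat.ceil_eq_iff (by omega), Nat.add_sub_cancel, lt_div_iff₀ hd', div_le_iff₀ hd',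
    lt_sub_iff_add_lt', sub_le_iff_le_add']
  norm_cast

open scoped Classical in
/-- The rounds up to `T` in which the index rule applies. -/
noncomputable def indexRounds (K G : ℕ) (b : ℝ) (T : ℕ) : Finset ℕ :=
  (Finset.Icc 1 T).filter (fun t => K * ceilLog b G < t ∧ ¬ IsExploration K b G t)

lemma mem_indexRounds {T t : ℕ} : t ∈ indexRounds K G b T ↔
    (1 ≤ t ∧ t ≤ T) ∧ K * ceilLog b G < t ∧ ¬ IsExploration K b G t := by
  simp [indexRounds]

/-- The pulls outside the index rounds number at most `⌈b log ((⌊T / G⌋ + 1) G)⌉`. -/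
lemma IsRun.pulls_le (h : IsRun K G b w I X) (hb : 0 ≤ b) (i : Fin K) (T : ℕ) :
    pulls I i T ≤ ceilLog b ((T / G + 1) * G) +
      ((indexRounds K G b T).filter (fun t => I t = i)).card := by
  classical
  -- The window of rounds that block `k` reserves for arm `i`; the window lengths telescope with the
  -- initialization.
  set J : ℕ → Finset ℕ := fun k =>
    Finset.Ioc (k * G + i * blockPulls b G k) (k * G + (i + 1) * blockPulls b G k)
  have hJ : ∀ k, (J k).card = blockPulls b G k := fun k => by
    simp only [J, Nat.card_Ioc, add_mul]; omega
  have hsub : pullRounds I i T ⊆ (pullRounds I i (K * ceilLog b G) ∪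
      (Finset.Icc 1 (T / G)).biUnion J) ∪
        (indexRounds K G b T).filter (fun t => I t = i) := by
    intro t ht
    obtain ⟨h1, h2⟩ := Finset.mem_filter.1 ht
    rw [Finset.mem_Icc] at h1
    by_cases h3 : t ≤ K * ceilLog b G
    · exact Finset.mem_union_left _ (Finset.mem_union_left _
        (Finset.mem_filter.2 ⟨Finset.mem_Icc.2 ⟨h1.1, h3⟩, h2⟩))
    by_cases h4 : IsExploration K b G t
    · refine Finset.mem_union_left _ (Finset.mem_union_right _ (Finset.mem_biUnion.2
        ⟨t / G, Finset.mem_Icc.2 ⟨h4.1, Nat.div_le_div_right h1.2⟩, ?_⟩))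
      exact Finset.mem_Ioc.2 ((h.arm_eq_iff (not_le.1 h3) h4 i).1 h2)
    · exact Finset.mem_union_right _ (Finset.mem_filter.2
        ⟨mem_indexRounds.2 ⟨h1, not_le.1 h3, h4⟩, h2⟩)
  refine (Finset.card_le_card hsub).trans ((Finset.card_union_le _ _).trans ?_)
  refine Nat.add_le_add_right ((Finset.card_union_le _ _).trans ?_) _
  rw [← ceilLog_add_sum_blockPulls hb]
  refine Nat.add_le_add (h.init i).le (Finset.card_biUnion_le.trans ?_)
  simp only [hJ, le_rfl]

/-- A block whose exploration phase lies after the initialization adds its pulls. -/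
lemma IsRun.pulls_add_blockPulls_le (h : IsRun K G b w I X) (i : Fin K) {k m : ℕ} (hk : 1 ≤ k)
    (h0 : K * ceilLog b G ≤ k * G) (hfit : K * blockPulls b G k < G)
    (hm : k * G + K * blockPulls b G k ≤ m) :
    pulls I i (k * G) + blockPulls b G k ≤ pulls I i m := by
  classical
  set d := blockPulls b G k with hd
  have hiK : ((i : ℕ) + 1) * d ≤ K * d := Nat.mul_le_mul_right d i.2
  set J := Finset.Ioc (k * G + i * d) (k * G + (i + 1) * d) with hJ
  have hcard : J.card = d := by simp only [hJ, Nat.card_Ioc, add_mul]; omega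
  have hdisj : Disjoint (pullRounds I i (k * G)) J := by
    refine Finset.disjoint_left.2 fun t ht ht' => ?_
    have h1 := (Finset.mem_Icc.1 (Finset.mem_filter.1 ht).1).2
    have h2 := (Finset.mem_Ioc.1 ht').1
    omega
  have hsub : pullRounds I i (k * G) ∪ J ⊆ pullRounds I i m := by
    refine Finset.union_subset (Finset.filter_subset_filter _
      (Finset.Icc_subset_Icc le_rfl (by omega))) fun t ht => ?_
    obtain ⟨h1, h2⟩ := Finset.mem_Ioc.1 ht
    -- The exploration phase is shorter than `G`, so it stays inside block `k`.
    have hdiv : t / G = k := by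
      rw [Nat.div_eq_iff (by omega)]
      constructor <;> omega
    have he : IsExploration K b G t := by
      exact ⟨by omega, by rw [hdiv]; omega, by rw [hdiv, ← hd]; omega⟩
    have := (h.arm_eq_iff (by omega) he i).2 (by rw [hdiv]; exact ⟨h1, h2⟩)
    exact Finset.mem_filter.2 ⟨Finset.mem_Icc.2 ⟨by omega, by omega⟩, this⟩
  calc pulls I i (k * G) + d = (pullRounds I i (k * G) ∪ J).card := by
        rw [Finset.card_union_of_disjoint hdisj, hcard]; rfl
    _ ≤ pulls I i m := Finset.card_le_card hsub

/-- The pulls after the exploration phase of block `k`; those of block `1` may be lost, since the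
initialization may take slightly more than `G` rounds. -/
lemma IsRun.ceilLog_le_pulls (h : IsRun K G b w I X) (hb : 0 ≤ b) (i : Fin K)
    (h0 : K * ceilLog b G ≤ 2 * G) (hfit : ∀ k, 1 ≤ k → K * blockPulls b G k < G)
    {k : ℕ} (hk : 1 ≤ k) : ∀ {m : ℕ}, K * ceilLog b G ≤ m → k * G + K * blockPulls b G k ≤ m →
    ceilLog b ((k + 1) * G) + ceilLog b G ≤ pulls I i m + ceilLog b (2 * G) := by
  induction k, hk using Nat.le_induction with
  | base =>
    intro m hm _
    have := pulls_mono I i hm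
    rw [h.init i] at this
    norm_num
    omega
  | succ k hk ih =>
    intro m hm hm'
    have h1 : K * ceilLog b G ≤ (k + 1) * G :=
      h0.trans (Nat.mul_le_mul_right G (by omega))
    have h2 := h.pulls_add_blockPulls_le i (by omega) h1 (hfit (k + 1) (by omega)) hm'
    have h3 := ih h1 (by have := hfit k hk; rw [add_mul]; omega)
    have h4 := ceilLog_add_blockPulls hb G (k + 1)
    omega

/-- In an index round `t` every arm has been pulled at least `(b log t) / 2` times. -/
lemma IsRun.mul_log_le_two_mul_pulls (h : IsRun K G b w I X) (hb : 8 ≤ b) (hG : 2 ≤ G)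
    (hKG : (K : ℝ) * b * Real.log G ≤ G) (i : Fin K) {t : ℕ} (ht : K * ceilLog b G < t)
    (he : ¬ IsExploration K b G t) : b * Real.log t ≤ 2 * pulls I i (t - 1) := by
  have hb0 : 0 ≤ b := by linarith
  have hK : (1 : ℝ) ≤ K := by exact_mod_cast (Nat.zero_le _).trans_lt i.2
  have hG' : (2 : ℝ) ≤ G := by exact_mod_cast hG
  have hlog2 := Real.log_two_gt_d9
  have hlog2' := Real.log_two_lt_d9
  have hlogG : Real.log 2 ≤ Real.log G := Real.log_le_log two_pos hG'
  -- With `b ≥ 8` the condition on `G` forces `G ≥ 4` and `G ≥ 8K`, which makes all rounding errors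
  -- harmless.
  have hKb : 8 * Real.log G * K ≤ K * b * Real.log G := by
    have := mul_le_mul_of_nonneg_right hb (mul_nonneg (by linarith : (0 : ℝ) ≤ K)
      (by linarith : 0 ≤ Real.log G))
    linarith
  have hG5 : (4 : ℝ) ≤ G := by nlinarith
  have hlogG4 : 2 * Real.log 2 ≤ Real.log G := by
    rw [show 2 * Real.log 2 = Real.log 4 by
      rw [show (4 : ℝ) = 2 ^ 2 by norm_num, Real.log_pow]; norm_num]
    exact Real.log_le_log (by norm_num) hG5
  have hpow : 8 * K ≤ (G : ℝ) := by nlinarith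
  have hfit : ∀ k, 1 ≤ k → K * blockPulls b G k < G := by
    intro k hk
    have hk' : (1 : ℝ) ≤ k := by exact_mod_cast hk
    have h1 := ceilLog_add_blockPulls hb0 G k
    have h2 := le_ceilLog b (k * G)
    have h3 := ceilLog_lt hb0 ((k + 1) * G)
    have h4 : Real.log ((k + 1) * G) ≤ Real.log 2 + Real.log (k * G) := by
      rw [← Real.log_mul two_ne_zero (by positivity)]
      exact Real.log_le_log (by positivity) (by nlinarith)
    rw [← h1] at h3
    push_cast at h2 h3
    have h5 : (blockPulls b G k : ℝ) < b * Real.log 2 + 1 := by nlinarith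
    have h6 : b * Real.log 2 + 1 ≤ b * Real.log G := by nlinarith
    have h7 : (K : ℝ) * blockPulls b G k < G := by nlinarith
    exact_mod_cast h7
  have h0 : K * ceilLog b G ≤ 2 * G := by
    have h1 := ceilLog_lt hb0 G
    have h2 : (K : ℝ) * ceilLog b G ≤ 2 * G := by nlinarith
    exact_mod_cast h2
  -- Losing block `1` costs at most `b log 2 + 1` pulls. Half of `b log ((k+1)G)`, which is at least
  -- `(3/2) b log 2`, covers this because `b ≥ 8`.
  have hmain : ∀ k, 1 ≤ k → k * G + K * blockPulls b G k ≤ t - 1 → t ≤ (k + 1) * G →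
      b * Real.log t ≤ 2 * pulls I i (t - 1) := by
    intro k hk h1 h2
    have h3 := h.ceilLog_le_pulls hb0 i h0 hfit hk (by omega) h1
    have h4 : ((ceilLog b ((k + 1) * G) : ℝ) + ceilLog b G) ≤
      pulls I i (t - 1) + ceilLog b (2 * G) := by exact_mod_cast h3
    have h5 := le_ceilLog b ((k + 1) * G)
    have h6 := le_ceilLog b G
    have h7 := ceilLog_lt hb0 (2 * G)
    have h8 : Real.log t ≤ Real.log (((k + 1) * G : ℕ) : ℝ) :=
      Real.log_le_log (by exact_mod_cast (by omega : 0 < t)) (by exact_mod_cast h2)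
    have h9 : Real.log (2 * G : ℕ) = Real.log 2 + Real.log G := by
      push_cast; exact Real.log_mul two_ne_zero (by positivity)
    have h10 : Real.log 2 + Real.log G ≤ Real.log (((k + 1) * G : ℕ) : ℝ) := by
      rw [← h9]
      exact Real.log_le_log (by exact_mod_cast (by omega : 0 < 2 * G))
        (by exact_mod_cast Nat.mul_le_mul_right G (by omega))
    rw [h9] at h7
    have h11 := mul_le_mul_of_nonneg_left h8 hb0
    have h12 := mul_le_mul_of_nonneg_left h10 hb0
    have h13 := mul_le_mul_of_nonneg_left hlogG4 hb0
    nlinarith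
  have hlow : t ≤ G → b * Real.log t ≤ 2 * pulls I i (t - 1) := by
    intro htG
    have h1 := pulls_mono I i (Nat.le_sub_one_of_lt ht)
    rw [h.init i] at h1
    have h2 : (ceilLog b G : ℝ) ≤ pulls I i (t - 1) := by exact_mod_cast h1
    have h3 := le_ceilLog b G
    have h4 : Real.log t ≤ Real.log G :=
      Real.log_le_log (by exact_mod_cast (by omega : 0 < t)) (by exact_mod_cast htG)
    have h5 := mul_le_mul_of_nonneg_left h4 hb0
    linarith [mul_nonneg hb0 (by linarith : 0 ≤ Real.log G)]
  rcases le_or_gt t G with htG | htG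
  · exact hlow htG
  have hdm := Nat.div_add_mod t G
  have hmod := Nat.mod_lt t (by omega : 0 < G)
  rw [mul_comm] at hdm
  have hk1 : 1 ≤ t / G := (Nat.one_le_div_iff (by omega)).2 htG.le
  -- A multiple `t = (k+1)G` is never an exploration round, since exploration starts at `(k+1)G +
  -- 1`; it counts as the last round of block `k`.
  rcases Nat.eq_zero_or_pos (t % G) with hz | hpos
  · obtain ⟨k, hk⟩ : ∃ k, t / G = k + 1 := ⟨t / G - 1, by omega⟩
    rw [hk, hz, add_mul] at hdm
    have hkpos : 1 ≤ k := by
      rcases Nat.eq_zero_or_pos k with rfl | hkp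
      · omega
      · exact hkp
    have := hfit k hkpos
    exact hmain k hkpos (by omega) (by rw [add_mul]; omega)
  · refine hmain (t / G) hk1 ?_ (by rw [add_mul]; omega)
    by_contra! hlt
    exact he ⟨hk1, by omega, by omega⟩

end Schedule

/-! ### An exponential supermartingale -/

section Chernoff

/-- At the extreme value `q = 1/2 - g` the bracket is `cosh g - 2 g sinh g`. This is at most `(1 +
g²) - 2g² = 1 - g² ≤ exp (-g²)`. -/
lemma exp_sq_mul_le_one {g q : ℝ} (h0 : 0 ≤ g) (h1 : g ≤ 1 / 2) (hq : q ≤ 1 / 2 - g) :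
    Real.exp (g ^ 2) * (Real.exp (-g) + (Real.exp g - Real.exp (-g)) * q) ≤ 1 := by
  have hcosh := Real.cosh_le_exp_half_sq g
  have hsinh : g ≤ Real.sinh g := Real.self_le_sinh_iff.2 h0
  have hle : Real.exp (g ^ 2 / 2) ≤ 1 + g ^ 2 := by
    have h2 : g ^ 2 ≤ 1 / 4 := by nlinarith
    have := Real.exp_bound_div_one_sub_of_interval (x := g ^ 2 / 2) (by positivity) (by linarith)
    refine this.trans ?_
    rw [div_le_iff₀ (by linarith)]
    nlinarith [sq_nonneg g]
  have hmul : (Real.exp g - Real.exp (-g)) * q ≤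
      (Real.exp g - Real.exp (-g)) * (1 / 2 - g) :=
    mul_le_mul_of_nonneg_left hq (sub_nonneg.2 (Real.exp_le_exp.2 (by linarith)))
  rw [Real.cosh_eq] at hcosh
  rw [Real.sinh_eq] at hsinh
  have h3 : Real.exp (-g) + (Real.exp g - Real.exp (-g)) * q ≤ 1 - g ^ 2 := by nlinarith
  have h4 : 1 - g ^ 2 ≤ Real.exp (-(g ^ 2)) := by
    linarith [Real.add_one_le_exp (-(g ^ 2))]
  calc _ ≤ Real.exp (g ^ 2) * Real.exp (-(g ^ 2)) :=
        mul_le_mul_of_nonneg_left (h3.trans h4) (Real.exp_pos _).le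
    _ = 1 := by rw [← Real.exp_add]; simp

variable {Ω : Type*}

open scoped Classical in
/-- The factor contributed by one round to the exponential supermartingale: `exp (g² + g)` if the
round is counted (`A`) and bad (`Z`), `exp (g² - g)` if it is counted and not bad, and `1` if it is
not counted. -/
noncomputable def chernoffFactor (g : ℝ) (A Z : Set Ω) (x : Ω) : ℝ≥0∞ :=
  if x ∈ A then (if x ∈ Z then ENNReal.ofReal (Real.exp (g ^ 2 + g))
    else ENNReal.ofReal (Real.exp (g ^ 2 - g))) else 1

lemma measurable_chernoffFactor {m : MeasurableSpace Ω} (g : ℝ) {A Z : Set Ω}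
    (hA : MeasurableSet[m] A) (hZ : MeasurableSet[m] Z) :
    Measurable[m] (chernoffFactor g A Z) :=
  Measurable.ite hA (Measurable.ite hZ measurable_const measurable_const) measurable_const

/-- One supermartingale step. On `A` the factor is at most `α + β 1_B + β 1_D`, so `B` and `D` each
need independence from the past only, not from one another. `exp_sq_mul_le_one` then bounds the mean
factor by `1`. -/
lemma lintegral_mul_chernoffFactor_le {m : MeasurableSpace Ω} [mΩ : MeasurableSpace Ω]
    {P : Measure Ω} [IsProbabilityMeasure P] (hm : m ≤ mΩ) {g : ℝ} (h0 : 0 ≤ g) (h1 : g ≤ 1 / 2)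
    {V : Ω → ℝ≥0∞} (hV : Measurable[m] V) {A B D : Set Ω} (hA : MeasurableSet[m] A)
    (hB : MeasurableSet B) (hD : MeasurableSet D)
    (hBi : IndepSets {t | MeasurableSet[m] t} {B} P)
    (hDi : IndepSets {t | MeasurableSet[m] t} {D} P)
    (hBD : P.real B + P.real D ≤ 1 / 2 - g) :
    ∫⁻ x, V x * chernoffFactor g A (B ∪ D) x ∂P ≤ ∫⁻ x, V x ∂P := by
  classical
  set α : ℝ≥0∞ := ENNReal.ofReal (Real.exp (g ^ 2 - g)) with hα
  set β : ℝ≥0∞ := ENNReal.ofReal (Real.exp (g ^ 2 + g) - Real.exp (g ^ 2 - g)) with hβ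
  have hβ0 : 0 ≤ Real.exp (g ^ 2 + g) - Real.exp (g ^ 2 - g) :=
    sub_nonneg.2 (Real.exp_le_exp.2 (by linarith))
  set W : Ω → ℝ≥0∞ := A.indicator V with hW
  have hWm : Measurable[m] W := hV.indicator hA
  have hWm' : Measurable W := hWm.mono hm le_rfl
  have hVm' : Measurable V := hV.mono hm le_rfl
  have key : ∀ x, V x * chernoffFactor g A (B ∪ D) x ≤
      Aᶜ.indicator V x + (W x * α + (W x * B.indicator (fun _ => β) x +
        W x * D.indicator (fun _ => β) x)) := by
    intro x
    have hαβ : ENNReal.ofReal (Real.exp (g ^ 2 + g)) = α + β := by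
      rw [hα, hβ, ← ENNReal.ofReal_add (Real.exp_pos _).le hβ0]; congr 1; ring
    by_cases hxA : x ∈ A
    · simp only [hW, Set.indicator, Set.mem_compl_iff, hxA, not_true_eq_false, if_false, if_true,
        chernoffFactor, Set.mem_union, hαβ, zero_add]
      by_cases hxB : x ∈ B <;> by_cases hxD : x ∈ D <;> simp [hxB, hxD, mul_add, ← add_assoc, ← hα]
    · simp [hW, chernoffFactor, hxA]
  calc ∫⁻ x, V x * chernoffFactor g A (B ∪ D) x ∂P
      ≤ ∫⁻ x, Aᶜ.indicator V x + (W x * α + (W x * B.indicator (fun _ => β) x +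
        W x * D.indicator (fun _ => β) x)) ∂P := lintegral_mono key
    _ = ∫⁻ x, Aᶜ.indicator V x ∂P + ((∫⁻ x, W x ∂P) * α + ((∫⁻ x, W x ∂P) * (β * P B) +
        (∫⁻ x, W x ∂P) * (β * P D))) := by
      rw [lintegral_add_left (hVm'.indicator (hm _ hA).compl),
        lintegral_add_left (hWm'.mul_const _), lintegral_mul_const _ hWm',
        lintegral_add_left (f := fun x => W x * B.indicator (fun _ => β) x)
          (hWm'.mul (measurable_const.indicator hB)),
        lintegral_mul_indicator_eq_lintegral_mul_lintegral_indicator hm β hB hBi hWm,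
        lintegral_mul_indicator_eq_lintegral_mul_lintegral_indicator hm β hD hDi hWm,
        lintegral_indicator_const hB, lintegral_indicator_const hD]
    _ = ∫⁻ x, Aᶜ.indicator V x ∂P + (∫⁻ x, W x ∂P) * (α + β * (P B + P D)) := by ring
    _ ≤ ∫⁻ x, Aᶜ.indicator V x ∂P + (∫⁻ x, W x ∂P) * 1 := by
      gcongr
      rw [← ofReal_measureReal (μ := P) (s := B), ← ofReal_measureReal (μ := P) (s := D),
        ← ENNReal.ofReal_add measureReal_nonneg measureReal_nonneg, hα, hβ,
        ← ENNReal.ofReal_mul hβ0,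
        ← ENNReal.ofReal_add (Real.exp_pos _).le (mul_nonneg hβ0 (by positivity))]
      refine ENNReal.ofReal_le_one.2 (le_of_eq_of_le ?_ (exp_sq_mul_le_one h0 h1 hBD))
      rw [sub_eq_add_neg, Real.exp_add, Real.exp_add]; ring
    _ = ∫⁻ x, V x ∂P := by
      rw [mul_one, hW, lintegral_indicator (hm _ hA), lintegral_indicator (hm _ hA).compl,
        add_comm, lintegral_add_compl _ (hm _ hA)]

open scoped Classical in
/-- Chernoff bound for adaptively chosen rounds: `A t` is the event that round `t` is counted, and
a counted round is bad on `B t ∪ D t`. -/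
theorem measureReal_card_le_two_mul_card_le [mΩ : MeasurableSpace Ω] {P : Measure Ω} [IsProbabilityMeasure P]
    (ℱ : Filtration ℕ mΩ) {A B D : ℕ → Set Ω} {g : ℝ} (h0 : 0 ≤ g) (h1 : g ≤ 1 / 2)
    (hA : ∀ t, MeasurableSet[ℱ t] (A (t + 1)))
    (hB : ∀ t, MeasurableSet[ℱ (t + 1)] (B (t + 1)))
    (hD : ∀ t, MeasurableSet[ℱ (t + 1)] (D (t + 1)))
    (hBi : ∀ t, IndepSets {s | MeasurableSet[ℱ t] s} {B (t + 1)} P)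
    (hDi : ∀ t, IndepSets {s | MeasurableSet[ℱ t] s} {D (t + 1)} P)
    (hBD : ∀ t, P.real (B (t + 1)) + P.real (D (t + 1)) ≤ 1 / 2 - g) (m n : ℕ) :
    P.real {x | ((Finset.Icc 1 m).filter (fun t => x ∈ A t)).card = n ∧
      n ≤ 2 * ((Finset.Icc 1 m).filter (fun t => x ∈ A t ∧ x ∈ B t ∪ D t)).card} ≤
      Real.exp (-(n * g ^ 2)) := by
  set V : ℕ → Ω → ℝ≥0∞ := fun m x =>
    ∏ t ∈ Finset.Icc 1 m, chernoffFactor g (A t) (B t ∪ D t) x with hV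
  have hsucc : ∀ m x, V (m + 1) x =
      V m x * chernoffFactor g (A (m + 1)) (B (m + 1) ∪ D (m + 1)) x := fun m x => by
    simp only [hV]
    rw [Finset.prod_Icc_succ_top (by omega)]
  have hVm : ∀ m, Measurable[ℱ m] (V m) := by
    intro m
    induction m with
    | zero => simp [hV]
    | succ m ih =>
      have : V (m + 1) = fun x =>
          V m x * chernoffFactor g (A (m + 1)) (B (m + 1) ∪ D (m + 1)) x := funext (hsucc m)
      rw [this]
      have hle := ℱ.mono (Nat.le_succ m)
      exact (ih.mono hle le_rfl).mul
        (measurable_chernoffFactor g (hle _ (hA m)) ((hB m).union (hD m)))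
  have hV1 : ∀ m, ∫⁻ x, V m x ∂P ≤ 1 := by
    intro m
    induction m with
    | zero => simp [hV]
    | succ m ih =>
      simp only [hsucc]
      exact (lintegral_mul_chernoffFactor_le (ℱ.le m) h0 h1 (hVm m) (hA m)
        (ℱ.le _ _ (hB m)) (ℱ.le _ _ (hD m)) (hBi m) (hDi m) (hBD m)).trans ih
  -- With `n` counted rounds of which at least half are bad, this exponent is at least `n (g² - g) +
  -- g n = n g²`; Markov's inequality for `V m` finishes.
  have hval : ∀ m x, V m x = ENNReal.ofReal (Real.exp
      (((Finset.Icc 1 m).filter (fun t => x ∈ A t)).card * (g ^ 2 - g) +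
        2 * g * ((Finset.Icc 1 m).filter (fun t => x ∈ A t ∧ x ∈ B t ∪ D t)).card)) := by
    intro m x
    induction m with
    | zero => simp [hV]
    | succ m ih =>
      rw [hsucc, ih, ← Finset.insert_Icc_right_eq_Icc_add_one (by omega),
        Finset.filter_insert, Finset.filter_insert]
      by_cases hxA : x ∈ A (m + 1)
      · by_cases hxZ : x ∈ B (m + 1) ∪ D (m + 1)
        · simp only [chernoffFactor, hxA, hxZ, if_true, and_self]
          rw [Finset.card_insert_of_notMem (by simp), Finset.card_insert_of_notMem (by simp),
            ← ENNReal.ofReal_mul (Real.exp_pos _).le, ← Real.exp_add]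
          congr 2; push_cast; ring
        · simp only [chernoffFactor, hxA, hxZ, if_true, and_false, if_false]
          rw [Finset.card_insert_of_notMem (by simp),
            ← ENNReal.ofReal_mul (Real.exp_pos _).le, ← Real.exp_add]
          congr 2; push_cast; ring
      · simp only [chernoffFactor, hxA, false_and, if_false, mul_one]
  set E : Set Ω := {x | ((Finset.Icc 1 m).filter (fun t => x ∈ A t)).card = n ∧
      n ≤ 2 * ((Finset.Icc 1 m).filter (fun t => x ∈ A t ∧ x ∈ B t ∪ D t)).card}
  have hE : E ⊆ {x | ENNReal.ofReal (Real.exp (n * g ^ 2)) ≤ V m x} := by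
    rintro x ⟨hx1, hx2⟩
    rw [Set.mem_ofPred_eq, hval, hx1]
    refine ENNReal.ofReal_le_ofReal (Real.exp_le_exp.2 ?_)
    have hx3 : (n : ℝ) ≤
        2 * ((Finset.Icc 1 m).filter (fun t => x ∈ A t ∧ x ∈ B t ∪ D t)).card := by
      exact_mod_cast hx2
    nlinarith
  have hmark := mul_meas_ge_le_lintegral (μ := P) ((hVm m).mono (ℱ.le m) le_rfl)
    (ENNReal.ofReal (Real.exp (n * g ^ 2)))
  have h2 : ENNReal.ofReal (Real.exp (n * g ^ 2)) * P E ≤ 1 :=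
    (mul_le_mul_right (measure_mono hE) _).trans (hmark.trans (hV1 m))
  rw [← ofReal_measureReal (μ := P) (s := E), ← ENNReal.ofReal_mul (Real.exp_pos _).le,
    ENNReal.ofReal_le_one] at h2
  rw [Real.exp_neg, ← one_div, le_div_iff₀ (Real.exp_pos _), mul_comm]
  exact h2

end Chernoff

/-! ### Failure probabilities of the confidence bounds -/

section Deviation

variable {Ω : Type*} [mΩ : MeasurableSpace Ω] {P : Measure Ω} [IsProbabilityMeasure P] {K : ℕ}
  {ν : Fin K → Measure ℝ} {ρ : ℝ} {ℱ : Filtration ℕ mΩ} {clean : Fin K → ℕ → Ω → ℝ}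
  {attack : ℕ → Set Ω} {η : ℕ → Ω → ℝ} {arm : ℕ → Ω → Fin K}

open scoped Classical in
/-- If the observed rewards lie in `H n` with conditional probability at most `1 / 2 - g n`, then
with high probability less than half of the `n` rewards observed up to round `t - 1` do. -/
lemma IsAttackedBandit.exists_deviation_event (h : IsAttackedBandit P ν ρ ℱ clean attack η arm)
    (i : Fin K) {t : ℕ} (ht : 2 ≤ t) {b : ℝ} (hb : 0 < b) {H : ℕ → Set ℝ}
    (hH : ∀ n, MeasurableSet (H n)) {g : ℕ → ℝ}
    (hg : ∀ n : ℕ, 1 ≤ n → b * Real.log t ≤ 2 * n → 0 ≤ g n ∧ g n ≤ 1 / 2 ∧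
      (ν i).real (H n) + ρ ≤ 1 / 2 - g n ∧ 3 * Real.log t ≤ n * g n ^ 2) :
    ∃ E, MeasurableSet E ∧ P.real E ≤ ((t : ℝ) ^ 2)⁻¹ ∧ ∀ x,
      b * Real.log t ≤ 2 * pulls (fun τ => arm τ x) i (t - 1) →
      ((pullRounds (fun τ => arm τ x) i (t - 1)).card ≤
        2 * ((pullRounds (fun τ => arm τ x) i (t - 1)).filter (fun τ =>
          observed clean attack η arm τ x ∈ H (pulls (fun τ => arm τ x) i (t - 1)))).card) →
      x ∈ E := by
  classical
  have ht0 : (0 : ℝ) < t := by exact_mod_cast (by omega : 0 < t)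
  have hlog : 0 < Real.log t := Real.log_pos (by exact_mod_cast ht)
  -- The number of pulls is random and the level set depends on it. Fixing its value `n` allows the
  -- Chernoff bound, and every attacked round is counted as bad.
  set F : ℕ → Set Ω := fun n =>
    {x | ((Finset.Icc 1 (t - 1)).filter (fun τ => x ∈ {x | arm τ x = i})).card = n ∧
      n ≤ 2 * ((Finset.Icc 1 (t - 1)).filter (fun τ => x ∈ {x | arm τ x = i} ∧
        x ∈ clean i τ ⁻¹' H n ∪ attack τ)).card} with hF
  set S := (Finset.range t).filter (fun n : ℕ => b * Real.log t ≤ 2 * n) with hS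
  have hFn : ∀ n ∈ S, P.real (F n) ≤ ((t : ℝ) ^ 3)⁻¹ := by
    intro n hn
    have hn2 := (Finset.mem_filter.1 hn).2
    have hn1 : 1 ≤ n := by
      have : (0 : ℝ) < n := by nlinarith [mul_pos hb hlog]
      exact_mod_cast this
    obtain ⟨h0, h1, h2, h3⟩ := hg n hn1 hn2
    have hclean : ∀ τ, IndepSets {s | MeasurableSet[ℱ τ] s} {clean i (τ + 1) ⁻¹' H n} P := by
      intro τ
      refine (IndepSets_iff _ _ _).2 fun s₁ s₂ hs₁ hs₂ => ?_
      rw [Set.mem_singleton_iff.1 hs₂]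
      exact (Indep_iff _ _ _).1 (h.clean_indep i τ).symm s₁ _ hs₁ ⟨H n, hH n, rfl⟩
    have hattack : ∀ τ, IndepSets {s | MeasurableSet[ℱ τ] s} {attack (τ + 1)} P := by
      intro τ
      refine (IndepSets_iff _ _ _).2 fun s₁ s₂ hs₁ hs₂ => ?_
      rw [Set.mem_singleton_iff.1 hs₂]
      exact (Indep_iff _ _ _).1 (h.attack_indep τ).symm s₁ _ hs₁
        (MeasurableSpace.measurableSet_generateFrom rfl)
    have hprob : ∀ τ, P.real (clean i (τ + 1) ⁻¹' H n) + P.real (attack (τ + 1)) ≤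
        1 / 2 - g n := by
      intro τ
      rw [h.attack_prob, ← map_measureReal_apply
        ((h.clean_adapted i τ).mono (ℱ.le _) le_rfl) (hH n), h.clean_law]
      exact h2
    have hch : P.real (F n) ≤ Real.exp (-(n * g n ^ 2)) := by
      convert measureReal_card_le_two_mul_card_le (P := P) ℱ (A := fun τ => {x | arm τ x = i})
        (B := fun τ => clean i τ ⁻¹' H n) (D := attack) h0 h1
        (fun τ => h.arm_predictable τ (measurableSet_singleton i))
        (fun τ => h.clean_adapted i τ (hH n)) h.attack_adapted hclean hattack hprob (t - 1) n
    refine hch.trans ?_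
    rw [← Real.exp_log (pow_pos ht0 3), ← Real.exp_neg, Real.log_pow]
    exact Real.exp_le_exp.2 (by push_cast; linarith)
  -- The measurable hull has the same probability, so measurability of the union need not be
  -- checked.
  refine ⟨toMeasurable P (⋃ n ∈ S, F n), measurableSet_toMeasurable _ _, ?_, ?_⟩
  · rw [measureReal_def, measure_toMeasurable]
    calc P.real (⋃ n ∈ S, F n) ≤ ∑ n ∈ S, P.real (F n) := measureReal_biUnion_finset_le _ _
      _ ≤ S.card • ((t : ℝ) ^ 3)⁻¹ := Finset.sum_le_card_nsmul _ _ _ hFn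
      _ ≤ t * ((t : ℝ) ^ 3)⁻¹ := by
        rw [nsmul_eq_mul]
        have : S.card ≤ t := (Finset.card_filter_le _ _).trans (Finset.card_range t).le
        gcongr
      _ = ((t : ℝ) ^ 2)⁻¹ := by field_simp
  · intro x hx1 hx2
    refine subset_toMeasurable _ _ (Set.mem_biUnion (x := pulls (fun τ => arm τ x) i (t - 1))
      (Finset.mem_coe.2 (Finset.mem_filter.2 ⟨Finset.mem_range.2 ?_, hx1⟩)) ⟨rfl, ?_⟩)
    · have := Finset.card_filter_le (Finset.Icc 1 (t - 1)) (fun τ => arm τ x = i)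
      rw [Nat.card_Icc] at this
      simp only [pulls, pullRounds]
      omega
    · refine hx2.trans (Nat.mul_le_mul_left 2 (Finset.card_le_card fun τ hτ => ?_))
      obtain ⟨h1, h2⟩ := Finset.mem_filter.1 hτ
      obtain ⟨h3, h4⟩ := Finset.mem_filter.1 h1
      refine Finset.mem_filter.2 ⟨h3, h4, ?_⟩
      by_cases ha : x ∈ attack τ
      · exact Or.inr ha
      · rw [observed, if_neg ha] at h2
        refine Or.inl ?_
        rw [← h4]
        simpa [h4] using h2

/-- The conditions on `b` and `w` are used here. If the minimum is the square root, `n (l ε)² = w l²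
L ≥ 3.5 L`. If it is `ξ`, put `c = l ξ`: then `b a² ≥ 2`, `b c² ≥ w l² ≥ 3.5` and `b a c ≥ 1` give
`b (a + c)² ≥ 6`, and `n ≥ b L / 2`. -/
lemma three_mul_log_le {a b w ξ l L n : ℝ} (ha : 0 < a) (hξ : 0 < ξ) (hl : 0 < l) (hL : 0 < L)
    (hn : 0 < n) (hb : max (w / ξ ^ 2) (2 / a ^ 2) ≤ b) (hw : (7 / 2) / l ^ 2 ≤ w)
    (hbn : b * L ≤ 2 * n) : 3 * L ≤ n * (a + l * min √(w * L / n) ξ) ^ 2 := by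
  have hw' : 7 / 2 ≤ w * l ^ 2 := by rwa [div_le_iff₀ (by positivity)] at hw
  have hwpos : 0 < w := lt_of_lt_of_le (by positivity) hw
  rcases le_total √(w * L / n) ξ with h | h
  · rw [min_eq_left h]
    have h1 : √(w * L / n) ^ 2 = w * L / n := Real.sq_sqrt (by positivity)
    have h2 : (l * √(w * L / n)) ^ 2 ≤ (a + l * √(w * L / n)) ^ 2 := by
      gcongr; linarith
    calc 3 * L ≤ w * l ^ 2 * L := by nlinarith
      _ = n * (l * √(w * L / n)) ^ 2 := by rw [mul_pow, h1]; field_simp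
      _ ≤ _ := by gcongr
  · rw [min_eq_right h]
    obtain ⟨hb1, hb2⟩ := max_le_iff.1 hb
    rw [div_le_iff₀ (by positivity)] at hb1 hb2
    have hb0 : 0 < b := by
      by_contra! hle
      nlinarith [sq_nonneg a]
    set c := l * ξ
    have hc : 0 < c := by positivity
    have h1 : 7 / 2 ≤ b * c ^ 2 := by
      have := mul_le_mul_of_nonneg_right hb1 (sq_nonneg l)
      simp only [c, mul_pow]; nlinarith
    have h2 : 1 ≤ b * (a * c) := by
      by_contra! hlt
      have h3 : (b * a ^ 2) * (b * c ^ 2) = (b * (a * c)) ^ 2 := by ring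
      have h4 : 0 < b * (a * c) := by positivity
      nlinarith
    have h5 : 6 ≤ b * (a + c) ^ 2 := by nlinarith
    have h6 := mul_le_mul_of_nonneg_right hbn (sq_nonneg (a + c))
    nlinarith

/-- Few of the rare events occur, by Markov's inequality. -/
lemma one_sub_le_measureReal_sum_indicator_le (hK : 0 < K) {E : Fin K → ℕ → Set Ω}
    (hE : ∀ i t, 2 ≤ t → MeasurableSet (E i t) ∧ P.real (E i t) ≤ ((t : ℝ) ^ 2)⁻¹) (T : ℕ)
    {δ : ℝ} (hδ : 0 < δ) :
    1 - δ ≤ P.real {x | ∑ t ∈ Finset.Ioc 1 T, ∑ i, (E i t).indicator (1 : Ω → ℝ) x ≤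
      2 * K / δ} := by
  set N : Ω → ℝ := fun x => ∑ t ∈ Finset.Ioc 1 T, ∑ i, (E i t).indicator (1 : Ω → ℝ) x
  have hK' : (0 : ℝ) < K := by exact_mod_cast hK
  have ht2 : ∀ t ∈ Finset.Ioc 1 T, 2 ≤ t := fun t ht => (Finset.mem_Ioc.1 ht).1
  have hint : ∀ t ∈ Finset.Ioc 1 T, ∀ i, Integrable ((E i t).indicator (1 : Ω → ℝ)) P :=
    fun t ht i => (integrable_const (1 : ℝ)).indicator (hE i t (ht2 t ht)).1
  have hNint : Integrable N P :=
    integrable_finsetSum _ fun t ht => integrable_finsetSum _ fun i _ => hint t ht i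
  have hNmeas : Measurable N := Finset.measurable_fun_sum _ fun t ht =>
    Finset.measurable_fun_sum _ fun i _ => measurable_one.indicator (hE i t (ht2 t ht)).1
  have hN0 : 0 ≤ N := fun x => Finset.sum_nonneg fun t _ => Finset.sum_nonneg fun i _ =>
    Set.indicator_nonneg (fun _ _ => zero_le_one) x
  have hNle : ∫ x, N x ∂P ≤ K := by
    calc ∫ x, N x ∂P = ∑ t ∈ Finset.Ioc 1 T, ∑ i, P.real (E i t) := by
          rw [integral_finsetSum _ fun t ht => integrable_finsetSum _ fun i _ => hint t ht i]
          refine Finset.sum_congr rfl fun t ht => ?_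
          rw [integral_finsetSum _ fun i _ => hint t ht i]
          exact Finset.sum_congr rfl fun i _ => integral_indicator_one (hE i t (ht2 t ht)).1
      _ ≤ ∑ t ∈ Finset.Ioc 1 T, (K : ℝ) * ((t : ℝ) ^ 2)⁻¹ := by
          refine Finset.sum_le_sum fun t ht => ?_
          refine (Finset.sum_le_card_nsmul _ _ _ fun i _ => (hE i t (ht2 t ht)).2).trans ?_
          simp
      -- The sum of `t⁻²` starts at `t = 2` and is therefore at most `1`.
      _ ≤ K * 1 := by
          rw [← Finset.mul_sum]
          refine mul_le_mul_of_nonneg_left ?_ hK'.le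
          rcases Nat.eq_zero_or_pos T with rfl | hT
          · simp
          · refine (sum_Ioc_inv_sq_le_sub one_ne_zero hT).trans ?_
            have : (0 : ℝ) ≤ (T : ℝ)⁻¹ := by positivity
            push_cast; rw [inv_one]; linarith
      _ = K := mul_one _
  have hmark := mul_meas_ge_le_integral_of_nonneg (Filter.Eventually.of_forall hN0) hNint
    (2 * K / δ)
  have h1 : P.real {x | 2 * K / δ ≤ N x} ≤ δ := by
    have h2 := hmark.trans hNle
    rw [div_mul_eq_mul_div, div_le_iff₀ hδ] at h2
    nlinarith
  have h3 : P.real {x | N x ≤ 2 * K / δ}ᶜ ≤ δ :=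
    by
    refine (measureReal_mono (s₂ := {x | 2 * K / δ ≤ N x}) fun x hx => ?_).trans h1
    exact (not_le.1 (show ¬ N x ≤ 2 * K / δ from hx)).le
  rw [probReal_compl_eq_one_sub (measurableSet_le hNmeas measurable_const)] at h3
  linarith

variable [∀ i, IsProbabilityMeasure (ν i)] {istar : Fin K} {s ξ l b w : ℝ}

/-- Outside a rare event no confidence bound fails in round `t`. -/
lemma IsAttackedBandit.exists_confidence_event (h : IsAttackedBandit P ν ρ ℱ clean attack η arm)
    (hQ : QuantileAssumption ν istar s ξ l) (hρ : ρ < s)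
    (hb : max (w / ξ ^ 2) (2 / (s - ρ) ^ 2) ≤ b) (hw : (7 / 2) / l ^ 2 ≤ w)
    (i : Fin K) {t : ℕ} (ht : 2 ≤ t) :
    ∃ E, MeasurableSet E ∧ P.real E ≤ ((t : ℝ) ^ 2)⁻¹ ∧ ∀ x,
      b * Real.log t ≤ 2 * pulls (fun τ => arm τ x) i (t - 1) →
      ((i = istar ∧ ucbIndex w (fun τ => arm τ x) (fun τ => observed clean attack η arm τ x) i t <
          quantile (cdf (ν i)) (1 / 2 - s)) ∨
        (i ≠ istar ∧ quantile (cdf (ν i)) (1 / 2 + s) +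
          √(w * Real.log t / (pulls (fun τ => arm τ x) i (t - 1) : ℝ)) <
          med (fun τ => arm τ x) (fun τ => observed clean attack η arm τ x) i (t - 1))) →
      x ∈ E := by
  have hlog : 0 < Real.log t := Real.log_pos (by exact_mod_cast ht)
  have ha : 0 < s - ρ := by linarith
  have hξ := hQ.ξ_pos
  have hl := hQ.l_pos
  have hb0 : 0 < b := lt_of_lt_of_le (by positivity) ((le_max_right _ _).trans hb)
  have hρ0 : 0 ≤ ρ := by rw [← h.attack_prob 0]; exact measureReal_nonneg
  -- The density bound reaches only as far as `ξ`, hence the truncation. A deviation beyond the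
  -- confidence width is also one beyond `ε`.
  set ε : ℕ → ℝ := fun n => min √(w * Real.log t / n) ξ with hε
  have hε0 : ∀ n, 0 ≤ ε n := fun n => le_min (Real.sqrt_nonneg _) hξ.le
  have hεξ : ∀ n, ε n ≤ ξ := fun n => min_le_right _ _
  have hεs : ∀ n, ε n ≤ √(w * Real.log t / n) := fun n => min_le_left _ _
  have hg : ∀ (H : Set ℝ) (n : ℕ), (ν i).real H ≤ 1 / 2 - s - l * ε n → 1 ≤ n →
      b * Real.log t ≤ 2 * n → 0 ≤ s - ρ + l * ε n ∧ s - ρ + l * ε n ≤ 1 / 2 ∧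
      (ν i).real H + ρ ≤ 1 / 2 - (s - ρ + l * ε n) ∧
        3 * Real.log t ≤ n * (s - ρ + l * ε n) ^ 2 := by
    intro H n hH hn hbn
    have h1 : 0 ≤ l * ε n := mul_nonneg hl.le (hε0 n)
    -- Nonnegativity of the tail probability, together with `ρ ≥ 0`, gives `g ≤ 1/2`.
    have h2 : 0 ≤ (ν i).real H := measureReal_nonneg
    exact ⟨by linarith, by linarith, by linarith, three_mul_log_le ha hξ hl hlog
      (by exact_mod_cast hn) hb hw hbn⟩
  have hne : ∀ x, b * Real.log t ≤ 2 * pulls (fun τ => arm τ x) i (t - 1) →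
      (pullRounds (fun τ => arm τ x) i (t - 1)).Nonempty := by
    intro x hx
    have : (0 : ℝ) < pulls (fun τ => arm τ x) i (t - 1) := by nlinarith [mul_pos hb0 hlog]
    exact Finset.card_pos.1 (by exact_mod_cast this)
  by_cases hi : i = istar
  · subst hi
    obtain ⟨E, hE1, hE2, hE3⟩ := h.exists_deviation_event i ht hb0
      (H := fun n => Set.Iic (quantile (cdf (ν i)) (1 / 2 - s) - ε n))
      (fun _ => measurableSet_Iic) (g := fun n => s - ρ + l * ε n)
      (fun n => hg _ n (hQ.real_Iic_le (hε0 n) (hεξ n)))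
    refine ⟨E, hE1, hE2, fun x hx1 hx2 => hE3 x hx1 ?_⟩
    rcases hx2 with ⟨-, hx2⟩ | ⟨hx2, -⟩
    · refine card_le_of_sampleMedian_lt (hne x hx1) ?_
      rw [ucbIndex, med] at hx2
      linarith [hεs (pulls (fun τ => arm τ x) i (t - 1))]
    · exact absurd rfl hx2
  · obtain ⟨E, hE1, hE2, hE3⟩ := h.exists_deviation_event i ht hb0
      (H := fun n => Set.Ioi (quantile (cdf (ν i)) (1 / 2 + s) + ε n))
      (fun _ => measurableSet_Ioi) (g := fun n => s - ρ + l * ε n)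
      (fun n => hg _ n (hQ.real_Ioi_le hi (hε0 n) (hεξ n)))
    refine ⟨E, hE1, hE2, fun x hx1 hx2 => hE3 x hx1 ?_⟩
    rcases hx2 with ⟨hx2, -⟩ | ⟨-, hx2⟩
    · exact absurd hx2 hi
    · refine card_le_of_lt_sampleMedian (hne x hx1) ?_
      rw [med] at hx2
      linarith [hεs (pulls (fun τ => arm τ x) i (t - 1))]

end Deviation

/-! ### From confidence bounds to regret -/

section Regret

variable {K : ℕ}

lemma regret_eq (ν : Fin K → Measure ℝ) (istar : Fin K) (I : ℕ → Fin K) (T : ℕ) :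
    regret ν istar I T =
      ∑ j ∈ Finset.univ.erase istar, (mean (ν istar) - mean (ν j)) * pulls I j T := by
  have h1 : regret ν istar I T = ∑ t ∈ Finset.Icc 1 T, (mean (ν istar) - mean (ν (I t))) := by
    rw [regret, Finset.sum_sub_distrib]; simp [mul_comm]
  rw [h1, ← Finset.sum_fiberwise (Finset.Icc 1 T) I,
    ← Finset.add_sum_erase _ _ (Finset.mem_univ istar)]
  have h2 : ∀ j, ∑ t ∈ Finset.Icc 1 T with I t = j, (mean (ν istar) - mean (ν (I t))) =
      (mean (ν istar) - mean (ν j)) * pulls I j T := by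
    intro j
    rw [Finset.sum_congr rfl fun t ht => by rw [(Finset.mem_filter.1 ht).2],
      Finset.sum_const, nsmul_eq_mul, mul_comm]
    rfl
  simp only [h2, sub_self, zero_mul, zero_add]

/-- An arm that is pulled often and has a smaller upper confidence bound is not pulled in an
index round unless a confidence bound fails. -/
lemma lt_or_lt_of_ucbIndex_le {w : ℝ} {I : ℕ → Fin K} {X : ℕ → ℝ} {i j : Fin K} {t : ℕ}
    {θ ϑ : ℝ} (hw : 0 < w) (hgap : ϑ < θ) (ht : 2 ≤ t)
    (hp : 4 * w * Real.log t / (θ - ϑ) ^ 2 < pulls I j (t - 1))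
    (h : ucbIndex w I X i t ≤ ucbIndex w I X j t) :
    ucbIndex w I X i t < θ ∨ ϑ + √(w * Real.log t / (pulls I j (t - 1) : ℝ)) <
      med I X j (t - 1) := by
  by_contra! hcon
  obtain ⟨h1, h2⟩ := hcon
  have hlog : 0 < Real.log t := Real.log_pos (by exact_mod_cast ht)
  have hgap' : 0 < θ - ϑ := sub_pos.2 hgap
  have hn : (0 : ℝ) < pulls I j (t - 1) := lt_of_le_of_lt (by positivity) hp
  -- Once the width is below half the gap, the index of `j` is at most `ϑ` plus two widths, hence
  -- below `θ`, which is at most the index of `i`.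
  have h3 : √(w * Real.log t / (pulls I j (t - 1) : ℝ)) < (θ - ϑ) / 2 := by
    rw [Real.sqrt_lt' (by positivity), div_lt_iff₀ hn]
    rw [div_lt_iff₀ (by positivity)] at hp
    linarith
  have h4 : ucbIndex w I X j t =
      med I X j (t - 1) + √(w * Real.log t / (pulls I j (t - 1) : ℝ)) := rfl
  linarith

/-- Deterministic UCB count, with `f` any nonnegative weight that is at least `1` at each relevant
failure. The `2` collects the rounding of the schedule and the first pull in the count up to `⌊u⌋`.
-/
lemma IsRun.pulls_le_of_confidence {G : ℕ} {b w : ℝ} {I : ℕ → Fin K} {X : ℕ → ℝ}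
    (h : IsRun K G b w I X) (hb : 0 < b) (hw : 0 < w) (hG : 2 ≤ G) {T : ℕ} (hT : G < T)
    {i j : Fin K} {θ ϑ : ℝ} (hgap : ϑ < θ) {f : Fin K → ℕ → ℝ}
    (hf0 : ∀ i t, 0 ≤ f i t)
    (hfi : ∀ t ∈ indexRounds K G b T, ucbIndex w I X i t < θ → 1 ≤ f i t)
    (hfj : ∀ t ∈ indexRounds K G b T, ϑ + √(w * Real.log t / (pulls I j (t - 1) : ℝ)) <
      med I X j (t - 1) → 1 ≤ f j t) :
    (pulls I j T : ℝ) ≤ b * Real.log (2 * T) + 4 * w * Real.log T / (θ - ϑ) ^ 2 + 2 +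
      ∑ t ∈ Finset.Ioc 1 T, ∑ i, f i t := by
  classical
  have hG0 : (0 : ℝ) < G := by exact_mod_cast (by omega : 0 < G)
  have hT0 : (1 : ℝ) < T := by exact_mod_cast (by omega : 1 < T)
  have hlogT := Real.log_pos hT0
  have hgap' : 0 < θ - ϑ := sub_pos.2 hgap
  set u := 4 * w * Real.log T / (θ - ϑ) ^ 2 with hu
  have hu0 : 0 ≤ u := by positivity
  have h2 : ∀ t ∈ indexRounds K G b T, 2 ≤ t := by
    intro t ht
    have h1 := (mem_indexRounds.1 ht).2.1
    have h3 : 0 < ceilLog b G :=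
      Nat.ceil_pos.2 (mul_pos hb (Real.log_pos (by exact_mod_cast hG)))
    have := Nat.mul_pos ((Nat.zero_le _).trans_lt j.2) h3
    omega
  -- Since `G < T`, the end of the current block is at most `2T`.
  have hexp : (ceilLog b ((T / G + 1) * G) : ℝ) ≤ b * Real.log (2 * T) + 1 := by
    refine (ceilLog_mono hb.le (n := 2 * T) ?_ |> Nat.cast_le.2).trans ?_
    · have := Nat.div_mul_le_self T G
      rw [add_mul]; omega
    · have := ceilLog_lt hb.le (2 * T)
      push_cast at this
      exact this.le
  have hsmall := card_filter_pulls_le I j (indexRounds K G b T) ⌊u⌋₊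
    (fun t ht => (mem_indexRounds.1 ht).1.1)
  set S := (indexRounds K G b T).filter (fun t => I t = j ∧ ¬ pulls I j (t - 1) ≤ ⌊u⌋₊) with hS
  have hlarge : (S.card : ℝ) ≤ ∑ t ∈ Finset.Ioc 1 T, ∑ i, f i t := by
    have hsum0 : ∀ t, 0 ≤ ∑ i, f i t := fun t => Finset.sum_nonneg fun i _ => hf0 i t
    calc (S.card : ℝ) = ∑ t ∈ S, 1 := by simp
      _ ≤ ∑ t ∈ S, ∑ i, f i t := by
        refine Finset.sum_le_sum fun t ht => ?_
        obtain ⟨ht1, ht2, ht3⟩ := Finset.mem_filter.1 ht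
        have ht' := mem_indexRounds.1 ht1
        have hidx := h.ucb t ht'.2.1 ht'.2.2 i
        rw [ht2] at hidx
        have hp : 4 * w * Real.log t / (θ - ϑ) ^ 2 < pulls I j (t - 1) := by
          refine lt_of_le_of_lt ?_ (Nat.lt_of_floor_lt (not_le.1 ht3))
          have : Real.log t ≤ Real.log T :=
            Real.log_le_log (by exact_mod_cast ht'.1.1) (by exact_mod_cast ht'.1.2)
          rw [hu]
          gcongr
        have hle : ∀ k, f k t ≤ ∑ i, f i t := fun k =>
          Finset.single_le_sum (f := fun i => f i t) (fun i _ => hf0 i t) (Finset.mem_univ k)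
        rcases lt_or_lt_of_ucbIndex_le hw hgap (h2 t ht1) hp hidx with h3 | h3
        · exact (hfi t ht1 h3).trans (hle i)
        · exact (hfj t ht1 h3).trans (hle j)
      _ ≤ _ := Finset.sum_le_sum_of_subset_of_nonneg (fun t ht => by
          have ht1 := (Finset.mem_filter.1 ht).1
          exact Finset.mem_Ioc.2 ⟨h2 t ht1, (mem_indexRounds.1 ht1).1.2⟩) fun t _ _ => hsum0 t
  have hsplit : ((indexRounds K G b T).filter (fun t => I t = j)).card ≤ ⌊u⌋₊ + 1 + S.card := by
    rw [← Finset.card_filter_add_card_filter_not (fun t => pulls I j (t - 1) ≤ ⌊u⌋₊),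
      Finset.filter_filter, Finset.filter_filter]
    exact Nat.add_le_add_right hsmall _
  have htot : (pulls I j T : ℝ) ≤ ceilLog b ((T / G + 1) * G) + (⌊u⌋₊ + 1 + S.card) := by
    exact_mod_cast (h.pulls_le hb.le j T).trans (Nat.add_le_add_left hsplit _)
  linarith [Nat.floor_le hu0]

/-- The bound on the number of pulls of arm `j` is at most a constant times `log T + 1 / δ`. -/
lemma pull_bound_le {b w q δ T : ℝ} (hb : 0 ≤ b) (hw : 0 ≤ w) (hT : 2 ≤ T) (hδ : 0 < δ)
    (hδ1 : δ ≤ 1) (K : ℕ) :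
    b * Real.log (2 * T) + 4 * w * Real.log T / q ^ 2 +
        (Real.exp 1 * (b * K / (2 * δ)) ^ (1 / 4 : ℝ) + 2 * K / δ + 3 + Real.pi ^ 2 / 3) ≤
      (2 * b + 4 * w / q ^ 2 + (Real.exp 1 * (1 + b * K / 2) + 2 * K + 3 + Real.pi ^ 2 / 3)) *
        (Real.log T + 1 / δ) := by
  have hlog : 0 ≤ Real.log T := Real.log_nonneg (by linarith)
  have hδ' : 1 ≤ 1 / δ := by rw [le_div_iff₀ hδ]; linarith
  have h1 : Real.log (2 * T) ≤ 2 * Real.log T := by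
    rw [Real.log_mul (by norm_num) (by linarith)]
    linarith [Real.log_le_log two_pos hT]
  -- Uses `y ^ (1/4) ≤ 1 + y` for `y ≥ 0`.
  have h2 : (b * K / (2 * δ)) ^ (1 / 4 : ℝ) ≤ (1 + b * K / 2) * (1 / δ) := by
    have hy : 0 ≤ b * K / (2 * δ) := by positivity
    have h3 : (b * K / (2 * δ)) ^ (1 / 4 : ℝ) ≤ 1 + b * K / (2 * δ) := by
      refine (Real.rpow_le_rpow hy (by linarith : _ ≤ 1 + b * K / (2 * δ)) (by norm_num)).trans ?_
      exact (Real.rpow_le_rpow_of_exponent_le (by linarith) (by norm_num)).trans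
        (Real.rpow_one _).le
    have h4 : (1 + b * K / 2) * (1 / δ) = 1 / δ + b * K / (2 * δ) := by field_simp
    linarith
  have h3 := mul_le_mul_of_nonneg_left h1 hb
  have h4 := mul_le_mul_of_nonneg_left h2 (Real.exp_pos 1).le
  have h5 : 4 * w * Real.log T / q ^ 2 = 4 * w / q ^ 2 * Real.log T := by ring
  have h6 : 2 * (K : ℝ) / δ = 2 * K * (1 / δ) := by ring
  have h7 : 0 ≤ 4 * w / q ^ 2 := by positivity
  have h8 : 0 ≤ Real.exp 1 * (1 + b * K / 2) := by positivity
  have h9 : 3 + Real.pi ^ 2 / 3 ≤ (3 + Real.pi ^ 2 / 3) * (1 / δ) :=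
    le_mul_of_one_le_right (by positivity) hδ'
  have h10 : 0 ≤ Real.exp 1 * (1 + b * K / 2) + 2 * K + 3 + Real.pi ^ 2 / 3 := by positivity
  have h11 : 0 ≤ 2 * b + 4 * w / q ^ 2 := by positivity
  rw [h5, h6]
  linarith [mul_nonneg h10 hlog, mul_nonneg h11 (by linarith : 0 ≤ 1 / δ)]

end Regret

end MedEUCB

/-! ### The regret bound -/

theorem theorem2 (K : ℕ) (ν : Fin K → Measure ℝ) [∀ i, IsProbabilityMeasure (ν i)]
    (hν : ∀ i, Integrable (fun x : ℝ => x) (ν i))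
    (istar : Fin K) (hstar : ∀ j, j ≠ istar → mean (ν j) < mean (ν istar))
    (s b w : ℝ) :
    ∃ C : ℝ, 0 < C ∧
      ∀ (ξ l ρ δ : ℝ) (G T : ℕ),
        QuantileAssumption ν istar s ξ l → ρ < s →
        max (w / ξ ^ 2) (2 / (s - ρ) ^ 2) ≤ b → (7 / 2) / l ^ 2 ≤ w →
        2 ≤ G → (K : ℝ) * b * Real.log G ≤ G → G < T →
        0 < δ → δ < 1 →
        ∀ {Ω : Type*} [mΩ : MeasurableSpace Ω] (P : Measure Ω) [IsProbabilityMeasure P]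
          (ℱ : Filtration ℕ mΩ) (clean : Fin K → ℕ → Ω → ℝ) (attack : ℕ → Set Ω)
          (η : ℕ → Ω → ℝ) (arm : ℕ → Ω → Fin K),
          IsAttackedBandit P ν ρ ℱ clean attack η arm →
          (∀ x, IsRun K G b w (fun t => arm t x) (fun t => observed clean attack η arm t x)) →
          1 - δ ≤ P.real {x | regret ν istar (fun t => arm t x) T ≤
            ∑ j ∈ Finset.univ.erase istar, (mean (ν istar) - mean (ν j)) *
              (b * Real.log (2 * T) + 4 * w * Real.log T / quantileGap ν istar s j ^ 2 +
                (Real.exp 1 * (b * K / (2 * δ)) ^ (1 / 4 : ℝ) + 2 * K / δ + 3 +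
                  Real.pi ^ 2 / 3))} ∧
          1 - δ ≤ P.real {x | regret ν istar (fun t => arm t x) T ≤
            C * (Real.log T + 1 / δ)} := by
  -- The constant is chosen before `b` and `w` are known to be nonnegative, hence the absolute
  -- values.
  set c : Fin K → ℝ := fun j => 2 * |b| + 4 * |w| / quantileGap ν istar s j ^ 2 +
    (Real.exp 1 * (1 + |b| * K / 2) + 2 * K + 3 + Real.pi ^ 2 / 3) with hc
  have hΔ : ∀ j ∈ Finset.univ.erase istar, 0 ≤ mean (ν istar) - mean (ν j) := fun j hj =>
    sub_nonneg.2 (hstar j (Finset.ne_of_mem_erase hj)).le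
  have hC : 0 ≤ ∑ j ∈ Finset.univ.erase istar, (mean (ν istar) - mean (ν j)) * c j :=
    Finset.sum_nonneg fun j hj => mul_nonneg (hΔ j hj) (by positivity)
  -- The added `1` keeps the constant positive when there is no suboptimal arm.
  refine ⟨1 + ∑ j ∈ Finset.univ.erase istar, (mean (ν istar) - mean (ν j)) * c j,
    by linarith, ?_⟩
  intro ξ l ρ δ G T hQ hρ hb hw hG hKG hGT hδ hδ1 Ω mΩ P _ ℱ clean attack η arm hA hrun
  have hK : 0 < K := (Nat.zero_le _).trans_lt istar.2
  have hξ := hQ.ξ_pos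
  have hl := hQ.l_pos
  have hs := hQ.s_lt
  have hρ0 : 0 ≤ ρ := by rw [← hA.attack_prob 0]; exact measureReal_nonneg
  have hw0 : 0 < w := lt_of_lt_of_le (by positivity) hw
  -- `0 < s - ρ < 1/2`, so `2 / (s - ρ)²` is at least `8`.
  have hb8 : 8 ≤ b := by
    refine le_trans ?_ ((le_max_right _ _).trans hb)
    rw [le_div_iff₀ (pow_pos (sub_pos.2 hρ) 2)]
    nlinarith
  have hT2 : (2 : ℝ) ≤ T := by exact_mod_cast (by omega : 2 ≤ T)
  have hlogT : 0 ≤ Real.log T := Real.log_nonneg (by linarith)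
  have hev : ∀ (i : Fin K) (t : ℕ), ∃ E : Set Ω, 2 ≤ t → MeasurableSet E ∧
      P.real E ≤ ((t : ℝ) ^ 2)⁻¹ ∧ ∀ x,
      b * Real.log t ≤ 2 * pulls (fun τ => arm τ x) i (t - 1) →
      ((i = istar ∧ ucbIndex w (fun τ => arm τ x) (fun τ => observed clean attack η arm τ x) i t <
          quantile (cdf (ν i)) (1 / 2 - s)) ∨
        (i ≠ istar ∧ quantile (cdf (ν i)) (1 / 2 + s) +
          √(w * Real.log t / (pulls (fun τ => arm τ x) i (t - 1) : ℝ)) <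
          med (fun τ => arm τ x) (fun τ => observed clean attack η arm τ x) i (t - 1))) →
      x ∈ E := by
    intro i t
    by_cases ht : 2 ≤ t
    · obtain ⟨E, hE⟩ := hA.exists_confidence_event hQ hρ hb hw i ht
      exact ⟨E, fun _ => hE⟩
    · exact ⟨∅, fun h => absurd h ht⟩
  choose E hE using hev
  have hprob := one_sub_le_measureReal_sum_indicator_le (P := P) hK (E := E)
    (fun i t ht => ⟨(hE i t ht).1, (hE i t ht).2.1⟩) T hδ
  -- Everything from here on is deterministic on the event of few failures, and this one event
  -- serves both bounds.
  have hpulls : ∀ x, ∑ t ∈ Finset.Ioc 1 T, ∑ i, (E i t).indicator (1 : Ω → ℝ) x ≤ 2 * K / δ →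
      ∀ j, j ≠ istar → (pulls (fun τ => arm τ x) j T : ℝ) ≤
        b * Real.log (2 * T) + 4 * w * Real.log T / quantileGap ν istar s j ^ 2 +
          (Real.exp 1 * (b * K / (2 * δ)) ^ (1 / 4 : ℝ) + 2 * K / δ + 3 + Real.pi ^ 2 / 3) := by
    intro x hx j hj
    have hround : ∀ t ∈ indexRounds K G b T, 2 ≤ t ∧
        ∀ i, b * Real.log t ≤ 2 * pulls (fun τ => arm τ x) i (t - 1) := by
      intro t ht
      have ht' := mem_indexRounds.1 ht
      have h1 : 0 < ceilLog b G :=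
        Nat.ceil_pos.2 (mul_pos (by linarith) (Real.log_pos (by exact_mod_cast hG)))
      have := Nat.mul_pos hK h1
      exact ⟨by omega, fun i => (hrun x).mul_log_le_two_mul_pulls hb8 hG hKG i ht'.2.1 ht'.2.2⟩
    have h1 := (hrun x).pulls_le_of_confidence (by linarith) hw0 hG hGT (i := istar) (j := j)
      (hQ.gap j hj) (f := fun i t => (E i t).indicator (1 : Ω → ℝ) x)
      (fun i t => Set.indicator_nonneg (fun _ _ => zero_le_one) x)
      (fun t ht h => by
        obtain ⟨h2, h3⟩ := hround t ht
        have := (hE istar t h2).2.2 x (h3 istar) (Or.inl ⟨rfl, h⟩)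
        simp [this])
      (fun t ht h => by
        obtain ⟨h2, h3⟩ := hround t ht
        have := (hE j t h2).2.2 x (h3 j) (Or.inr ⟨hj, h⟩)
        simp [this])
    have h2 : 0 ≤ Real.exp 1 * (b * K / (2 * δ)) ^ (1 / 4 : ℝ) := by positivity
    have h3 : 0 ≤ Real.pi ^ 2 / 3 := by positivity
    rw [quantileGap]
    linarith
  constructor
  · refine hprob.trans (measureReal_mono fun x hx => ?_)
    change regret ν istar (fun t => arm t x) T ≤ _
    rw [regret_eq]
    exact Finset.sum_le_sum fun j hj => mul_le_mul_of_nonneg_left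
      (hpulls x hx j (Finset.ne_of_mem_erase hj)) (hΔ j hj)
  · refine hprob.trans (measureReal_mono fun x hx => ?_)
    change regret ν istar (fun t => arm t x) T ≤ _
    have hδ' : 0 ≤ 1 / δ := by positivity
    rw [regret_eq, add_mul, Finset.sum_mul]
    refine le_add_of_nonneg_of_le (by positivity) (Finset.sum_le_sum fun j hj => ?_)
    rw [mul_assoc]
    refine mul_le_mul_of_nonneg_left ((hpulls x hx j (Finset.ne_of_mem_erase hj)).trans ?_)
      (hΔ j hj)
    simp only [hc, abs_of_nonneg (by linarith : 0 ≤ b), abs_of_pos hw0]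
    exact pull_bound_le (by linarith) hw0.le hT2 hδ hδ1.le K
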